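/- Let $\mathcal H$ be a finite-dimensional complex Hilbert space and let $\mathcal L(\mathcal H)$ be the algebra of operators on $\mathcal H$. A quantum channel on $\mathcal H$ is a completely positive, trace-preserving linear map $\mathcal L(\mathcal H)\to\mathcal L(\mathcal H)$. For a linear map $\Phi$ on $\mathcal L(\mathcal H)$ let $\Phi^\dagger$ be its dual with respect to the Hilbert--Schmidt inner product $\langle X,Y\rangle=\mathrm{Tr}(X^\dagger Y)$. Let $\mathcal E$ be a quantum channel with operation elements $E_a$, that is, $\mathcal E(\rho)=\sum_a E_a\rho E_a^\dagger$ (a finite sum) for all $\rho$. Let $P$ be an orthogonal projection on $\mathcal H$, and let $\mathcal A$ be a subalgebra of $\mathcal L(P\mathcal H)$, that is, a linear subspace of $\{X\in\mathcal L(\mathcal H): PXP=X\}$ closed under products and under Hermitian conjugation (it need not contain $P$). The following statements are equivalent: 1. $\mathcal A$ is correctable for $\mathcal E$ on states in $P\mathcal H$: there is a quantum channel $\mathcal R$ on $\mathcal H$ such that $P(\mathcal R\circ\mathcal E)^\dagger(X)P=PXP$ for all $X\in\mathcal A$. 2. $[PE_a^\dagger E_bP,X]=0$ for all $X\in\mathcal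 A$ and all $a,b$. -/

import Mathlib

noncomputable section

namespace OAQEC

variable {H : Type*} [NormedAddCommGroup H] [InnerProductSpace ℂ H]

/-- The trace of an operator on a (finite-dimensional) Hilbert space, as a linear functional. -/
def tr : (H →L[ℂ] H) →ₗ[ℂ] ℂ :=
  LinearMap.trace ℂ H ∘ₗ ContinuousLinearMap.coeLM ℂ

theorem tr_mul_comm (X Y : H →L[ℂ] H) : tr (X * Y) = tr (Y * X) :=
  LinearMap.trace_mul_comm ℂ (X : H →ₗ[ℂ] H) (Y : H →ₗ[ℂ] H)

variable [FiniteDimensional ℂ H]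

/-- The matrix unit `|e_i⟩⟨e_j|` of the standard orthonormal basis of `H`. -/
def matrixUnit (i j : Fin (Module.finrank ℂ H)) : H →L[ℂ] H :=
  InnerProductSpace.rankOne ℂ (stdOrthonormalBasis ℂ H i) (stdOrthonormalBasis ℂ H j)

theorem tr_mul_matrixUnit (X : H →L[ℂ] H) (i j : Fin (Module.finrank ℂ H)) :
    tr (X * matrixUnit i j) =
      inner ℂ (stdOrthonormalBasis ℂ H j) (X (stdOrthonormalBasis ℂ H i)) := by
  have h : X * matrixUnit i j = InnerProductSpace.rankOne ℂ (X (stdOrthonormalBasis ℂ H i))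
      (stdOrthonormalBasis ℂ H j) := by
    ext v
    simp [matrixUnit]
  rw [h]
  exact InnerProductSpace.trace_rankOne _ _

theorem eq_sum_matrixUnit (Y : H →L[ℂ] H) :
    Y = ∑ i, ∑ j, (inner ℂ (stdOrthonormalBasis ℂ H i) (Y (stdOrthonormalBasis ℂ H j)) : ℂ) •
      matrixUnit i j := by
  ext v
  conv_lhs => rw [← (stdOrthonormalBasis ℂ H).sum_repr' v]
  simp only [map_sum, map_smul, sum_apply, smul_apply,
    matrixUnit, InnerProductSpace.rankOne_apply]
  rw [Finset.sum_comm]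
  refine Finset.sum_congr rfl fun j _ => ?_
  conv_lhs => rw [← (stdOrthonormalBasis ℂ H).sum_repr' (Y (stdOrthonormalBasis ℂ H j))]
  rw [Finset.smul_sum]
  exact Finset.sum_congr rfl fun i _ => smul_comm _ _ _

/-! A finite-dimensional space is automatically complete; the instance `CompleteSpace H` is listed
only because Mathlib's adjoint and C⋆-algebra structure on `H →L[ℂ] H` ask for it. -/
variable [CompleteSpace H]

/-- The Hilbert-Schmidt dual `Φ†` of a linear map `Φ` on `L(H)`: its adjoint for the inner
product `⟨X, Y⟩ = Tr(X† Y)`, written out in the orthonormal basis of matrix units. It is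
characterized by `tr_star_hsDual_mul`. -/
def hsDual (Φ : (H →L[ℂ] H) →ₗ[ℂ] (H →L[ℂ] H)) : (H →L[ℂ] H) →ₗ[ℂ] (H →L[ℂ] H) :=
  ∑ i, ∑ j, LinearMap.toSpanSingleton ℂ (H →L[ℂ] H) (matrixUnit i j) ∘ₗ tr ∘ₗ
    LinearMap.mulLeft ℂ (star (Φ (matrixUnit i j)))

variable (H) in
/-- A quantum channel on `H` (Schrödinger picture): a completely positive, trace-preserving linear
map `L(H) → L(H)`. -/
structure Channel extends CompletelyPositiveMap (H →L[ℂ] H) (H →L[ℂ] H) where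
  trace_preserving (ρ : H →L[ℂ] H) : tr (toLinearMap ρ) = tr ρ

/-- The operators `E a` are operation elements of `𝓔`: `𝓔(ρ) = ∑ₐ Eₐ ρ Eₐ†`. -/
def Channel.HasOperationElements {ι : Type*} [Fintype ι] (𝓔 : Channel H)
    (E : ι → (H →L[ℂ] H)) : Prop :=
  ∀ ρ : H →L[ℂ] H, 𝓔.toLinearMap ρ = ∑ a, E a * ρ * star (E a)

/-- The set `S` of operators is conserved by `Φ` on states in `PH`: `P Φ†(X) P = P X P` for all
`X` in `S`. -/
def IsConserved (S : Set (H →L[ℂ] H)) (Φ : (H →L[ℂ] H) →ₗ[ℂ] (H →L[ℂ] H))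
    (P : H →L[ℂ] H) : Prop :=
  ∀ X ∈ S, P * hsDual Φ X * P = P * X * P

/-- The set `S` of operators is correctable for `𝓔` on states in `PH`: some channel `𝓡` is such
that `S` is conserved by `𝓡 ∘ 𝓔` on states in `PH`. -/
def IsCorrectable (S : Set (H →L[ℂ] H)) (𝓔 : Channel H) (P : H →L[ℂ] H) : Prop :=
  ∃ 𝓡 : Channel H, IsConserved S (𝓡.toLinearMap ∘ₗ 𝓔.toLinearMap) P

/-! ### The defining property of the dual -/

theorem tr_star (X : H →L[ℂ] H) : tr (star X) = star (tr X) := by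
  have h (Z : H →L[ℂ] H) := LinearMap.trace_eq_sum_inner (Z : H →ₗ[ℂ] H) (stdOrthonormalBasis ℂ H)
  simp only [tr, LinearMap.comp_apply, ContinuousLinearMap.coeLM_apply, h, star_sum]
  refine Finset.sum_congr rfl fun i _ => ?_
  simp [ContinuousLinearMap.star_eq_adjoint, ContinuousLinearMap.adjoint_inner_right]

/-- `⟨Φ†(X), Y⟩ = ⟨X, Φ(Y)⟩` for the Hilbert-Schmidt inner product `⟨X, Y⟩ = Tr(X† Y)`. -/
theorem tr_star_hsDual_mul (Φ : (H →L[ℂ] H) →ₗ[ℂ] (H →L[ℂ] H)) (X Y : H →L[ℂ] H) :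
    tr (star (hsDual Φ X) * Y) = tr (star X * Φ Y) := by
  conv_rhs => rw [eq_sum_matrixUnit Y]
  simp only [hsDual, LinearMap.sum_apply, LinearMap.comp_apply, LinearMap.mulLeft_apply,
    LinearMap.toSpanSingleton_apply, star_sum, Finset.sum_mul, Finset.mul_sum, map_sum, map_smul,
    star_smul, smul_mul_assoc, mul_smul_comm, smul_eq_mul]
  refine Finset.sum_congr rfl fun i _ => Finset.sum_congr rfl fun j _ => ?_
  have h1 : tr (star (matrixUnit i j) * Y) =
      inner ℂ (stdOrthonormalBasis ℂ H i) (Y (stdOrthonormalBasis ℂ H j)) := by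
    have : star (matrixUnit (H := H) i j) = matrixUnit j i := by
      simp [matrixUnit, ContinuousLinearMap.star_eq_adjoint]
    rw [this, tr_mul_comm, tr_mul_matrixUnit]
  rw [h1, ← tr_star, star_mul, star_star, mul_comm]

end OAQEC

end

namespace OAQEC

/-! ### Equality in the Kadison–Schwarz inequality. -/

section CStarAlgebra

variable {A : Type*} [CStarAlgebra A] [PartialOrder A] [StarOrderedRing A] {κ : Type*} [Fintype κ]

/-! Correctable implies commuting: if `R d` are operation elements of the recovery, the dual of
recovery after noise, compressed to `P`, fixes both `X` and `X† X`. This is equality in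
Kadison–Schwarz, so `X R_d E_a P = R_d E_a X` (`mul_mul_eq_of_compression`). Multiplying by the
adjoint relations and summing over `d` with `∑ R† R = 1` eliminates the recovery.

Conversely, put `F_a = E_a P` and `M = ∑ F_a F_a†`. The elements `F_a† M^{-1/2}` recover:
commutation gives `Y F_a = M F_a X` for `Y = ∑ F_a X F_a†`, hence `M^{-1/2} Y M^{-1/2} F_a = F_a X`,
and `∑ F_a† F_a = P` returns `X`. -/

theorem sum_star_mul_self_eq_zero {T : κ → A} (h : ∑ c, star (T c) * T c = 0) (c : κ) :
    T c = 0 := by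
  have := (Finset.sum_eq_zero_iff_of_nonneg fun c _ => star_mul_self_nonneg (T c)).mp h c
    (Finset.mem_univ c)
  exact CStarRing.star_mul_self_eq_zero_iff _ |>.mp this

/-- If the compression to `P` of the unital map `Y ↦ ∑ K† Y K` fixes `X` and `X† X`, then the `K`
intertwine `X`. -/
theorem mul_mul_eq_of_compression {P X : A} {K : κ → A}
    (hP : IsStarProjection P) (hPX : P * X * P = X) (hK : ∑ c, star (K c) * K c = 1)
    (h1 : P * (∑ c, star (K c) * X * K c) * P = X)
    (h2 : P * (∑ c, star (K c) * (star X * X) * K c) * P = star X * X) (c : κ) :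
    X * K c * P = K c * X := by
  have hp : star P = P := hP.isSelfAdjoint
  have hpp : P * P = P := hP.isIdempotentElem
  have hl : P * X = X := by rw [← hPX]; simp only [← mul_assoc, hpp]
  have h1s : P * (∑ c, star (K c) * star X * K c) * P = star X := by
    conv_rhs => rw [← h1]
    simp only [star_mul, star_sum, star_star, hp, mul_assoc]
  refine sub_eq_zero.mp (sum_star_mul_self_eq_zero (T := fun c => X * K c * P - K c * X) ?_ c)
  -- Since `P X = X`, a `P` can be inserted so that every term is a compression. Summed over `c`,
  -- each of the four terms is `± X† X`, and they cancel.
  have e : ∀ c, star (X * K c * P - K c * X) * (X * K c * P - K c * X) =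
      P * (star (K c) * (star X * X) * K c) * P - P * (star (K c) * star X * K c) * P * X
        - star X * (P * (star (K c) * X * K c) * P) + star X * (star (K c) * K c) * X := fun c => by
    have hls : star X * P = star X := by rw [← star_inj]; simp [hp, hl]
    have hls' : ∀ Y, star X * (P * Y) = star X * Y := fun Y => by rw [← mul_assoc, hls]
    simp only [star_sub, star_mul, hp, sub_mul, mul_sub, mul_assoc, hl, hls']
    abel
  simp only [e, Finset.sum_add_distrib, Finset.sum_sub_distrib, ← Finset.mul_sum,
    ← Finset.sum_mul]
  rw [h1, h2, h1s, hK]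
  simp

end CStarAlgebra

theorem exists_eq_star_mul_self_of_nonneg {A : Type*} [NonUnitalCStarAlgebra A] [PartialOrder A]
    [StarOrderedRing A] {a : A} (ha : 0 ≤ a) : ∃ b, a = star b * b :=
  CStarAlgebra.nonneg_iff_eq_star_mul_self.mp ha

/-! ### Trace duality, spectra and matrix units. -/

section Trace

variable {H : Type*} [NormedAddCommGroup H] [InnerProductSpace ℂ H] [FiniteDimensional ℂ H]

theorem eq_of_forall_tr_mul_eq {A B : H →L[ℂ] H} (h : ∀ Y, tr (A * Y) = tr (B * Y)) : A = B := by
  rw [eq_sum_matrixUnit A, eq_sum_matrixUnit B]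
  refine Finset.sum_congr rfl fun i _ => Finset.sum_congr rfl fun j _ => ?_
  rw [← tr_mul_matrixUnit, ← tr_mul_matrixUnit, h]

/-- Every real function is continuous on a finite set, so functional calculus applies to `1/√x` even
when 0 is an eigenvalue. -/
theorem finite_spectrum_real [CompleteSpace H] (M : H →L[ℂ] H) : (spectrum ℝ M).Finite := by
  have h : (spectrum ℂ M).Finite := by
    rw [← AlgEquiv.spectrum_eq (Module.End.toContinuousLinearMap H).symm M]
    exact Module.End.finite_spectrum _
  rw [← spectrum.preimage_algebraMap (R := ℝ) ℂ]
  exact h.preimage (FaithfulSMul.algebraMap_injective ℝ ℂ).injOn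

theorem matrixUnit_mul_matrixUnit (i j k : Fin (Module.finrank ℂ H)) :
    matrixUnit (H := H) i j * matrixUnit j k = matrixUnit i k := by
  ext v
  simp [matrixUnit]

theorem mul_matrixUnit_mul_star [CompleteSpace H] (K : H →L[ℂ] H)
    (i j : Fin (Module.finrank ℂ H)) :
    K * matrixUnit i j * star K = InnerProductSpace.rankOne ℂ (K (stdOrthonormalBasis ℂ H i))
      (K (stdOrthonormalBasis ℂ H j)) := by
  ext v
  simp [matrixUnit, ContinuousLinearMap.star_eq_adjoint, ContinuousLinearMap.adjoint_inner_right]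

theorem star_matrixUnit [CompleteSpace H] (i j : Fin (Module.finrank ℂ H)) :
    star (matrixUnit (H := H) i j) = matrixUnit j i := by
  simp [matrixUnit, ContinuousLinearMap.star_eq_adjoint]

end Trace

/-! ### Operation elements of channels. -/

section Kraus

variable {H : Type*} [NormedAddCommGroup H] [InnerProductSpace ℂ H] [FiniteDimensional ℂ H]
  [CompleteSpace H] {κ : Type*} [Fintype κ]

theorem hsDual_eq_sum {Φ : (H →L[ℂ] H) →ₗ[ℂ] (H →L[ℂ] H)} {K : κ → (H →L[ℂ] H)}
    (hK : ∀ ρ, Φ ρ = ∑ c, K c * ρ * star (K c)) (X : H →L[ℂ] H) :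
    hsDual Φ X = ∑ c, star (K c) * X * K c := by
  rw [← star_inj]
  refine eq_of_forall_tr_mul_eq fun Y => ?_
  rw [tr_star_hsDual_mul, hK]
  simp only [star_sum, Finset.sum_mul, Finset.mul_sum, map_sum]
  refine Finset.sum_congr rfl fun c _ => ?_
  simp only [star_mul, star_star, mul_assoc]
  rw [tr_mul_comm (star (K c))]
  simp only [mul_assoc]

theorem Channel.sum_star_mul_self {𝓔 : Channel H} {K : κ → (H →L[ℂ] H)}
    (hK : 𝓔.HasOperationElements K) : ∑ c, star (K c) * K c = 1 := by
  refine eq_of_forall_tr_mul_eq fun Y => ?_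
  rw [one_mul, ← 𝓔.trace_preserving Y, hK]
  simp only [Finset.sum_mul, map_sum]
  refine Finset.sum_congr rfl fun c _ => ?_
  rw [mul_assoc, tr_mul_comm]

/-- The channel `ρ ↦ ∑ K ρ K†` given by operators with `∑ K† K = 1`. -/
noncomputable def Channel.ofOperationElements (K : κ → (H →L[ℂ] H))
    (hK : ∑ c, star (K c) * K c = 1) : Channel H where
  toLinearMap := (∑ c, LinearMap.mulLeftRight ℂ (K c, star (K c)) : Module.End ℂ (H →L[ℂ] H))
  map_cstarMatrix_nonneg' k M hM := by
    obtain ⟨N, rfl⟩ := exists_eq_star_mul_self_of_nonneg hM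
    -- With `D = diag(K†)`, conjugating each entry of `N† N` by `K` gives `(N D)† (N D)`.
    have h : ∀ c, 0 ≤ star (N * CStarMatrix.ofMatrix (Matrix.diagonal fun _ => star (K c))) *
        (N * CStarMatrix.ofMatrix (Matrix.diagonal fun _ => star (K c))) :=
      fun c => star_mul_self_nonneg _
    convert Finset.sum_nonneg fun c (_ : c ∈ Finset.univ) => h c using 1
    ext1 i j
    have hs : ∀ f : κ → CStarMatrix (Fin k) (Fin k) (H →L[ℂ] H), (∑ c, f c) i j = ∑ c, f c i j :=
      fun f => map_sum (⟨⟨fun M => M i j, rfl⟩, fun _ _ => rfl⟩ :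
        CStarMatrix (Fin k) (Fin k) (H →L[ℂ] H) →+ (H →L[ℂ] H)) f Finset.univ
    have hd : ∀ c l m, (N * CStarMatrix.ofMatrix (Matrix.diagonal fun _ => star (K c)) :
        CStarMatrix (Fin k) (Fin k) (H →L[ℂ] H)) l m =
        N l m * star (K c) := fun c l m => Matrix.mul_diagonal _ _ _ _
    have hc : ∀ L : CStarMatrix (Fin k) (Fin k) (H →L[ℂ] H),
        (star L * L) i j = ∑ x, star (L x i) * L x j := fun L => CStarMatrix.mul_apply
    rw [hs]
    change (∑ c, LinearMap.mulLeftRight ℂ (K c, star (K c)) : Module.End ℂ (H →L[ℂ] H))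
      ((star N * N) i j) = _
    simp only [LinearMap.sum_apply, LinearMap.mulLeftRight_apply, hc, hd]
    simp only [star_mul, star_star, Finset.mul_sum, Finset.sum_mul, mul_assoc]
  trace_preserving ρ := by
    simp only [LinearMap.sum_apply, LinearMap.mulLeftRight_apply, map_sum]
    conv_rhs => rw [← one_mul ρ, ← hK]
    simp only [Finset.sum_mul, map_sum]
    refine Finset.sum_congr rfl fun c _ => ?_
    rw [tr_mul_comm, mul_assoc]

omit [FiniteDimensional ℂ H] in
theorem Channel.hasOperationElements_ofOperationElements (K : κ → (H →L[ℂ] H))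
    (hK : ∑ c, star (K c) * K c = 1) : (Channel.ofOperationElements K hK).HasOperationElements K :=
  fun ρ => by simp [Channel.ofOperationElements]

/-- The Choi matrix of the identity map is positive. -/
theorem matrixUnit_nonneg :
    0 ≤ CStarMatrix.ofMatrix (Matrix.of (matrixUnit (H := H))) := by
  -- The square of the matrix of units is `n` times itself, so scaling by `1/√n` gives a factor `N`
  -- with `N† N` equal to it.
  let r : ℂ := ((Real.sqrt (Module.finrank ℂ H))⁻¹ : ℝ)
  let N : CStarMatrix (Fin (Module.finrank ℂ H)) (Fin (Module.finrank ℂ H)) (H →L[ℂ] H) :=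
    CStarMatrix.ofMatrix (Matrix.of fun i j => r • matrixUnit i j)
  have hN : CStarMatrix.ofMatrix (Matrix.of (matrixUnit (H := H))) = star N * N := by
    ext1 i j
    have h0 : (Module.finrank ℂ H : ℝ) ≠ 0 := by
      exact_mod_cast (Fin.pos i).ne'
    have h1 : (Module.finrank ℂ H : ℂ) * (r * r) = 1 := by
      have : (Module.finrank ℂ H : ℝ) * ((Real.sqrt (Module.finrank ℂ H))⁻¹ *
          (Real.sqrt (Module.finrank ℂ H))⁻¹) = 1 := by
        rw [← mul_inv, Real.mul_self_sqrt (Nat.cast_nonneg _), mul_inv_cancel₀ h0]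
      simpa only [r, ← Complex.ofReal_mul, ← Complex.ofReal_natCast, Complex.ofReal_eq_one] using this
    have h2 : star r = r := Complex.conj_ofReal _
    rw [CStarMatrix.mul_apply]
    have h3 : ∀ k, star N i k * N k j = (r * r) • matrixUnit i j := fun k => by
      change star (r • matrixUnit k i) * (r • matrixUnit k j) = _
      rw [star_smul, star_matrixUnit, h2, smul_mul_smul_comm, matrixUnit_mul_matrixUnit]
    simp only [h3, Finset.sum_const, Finset.card_univ, Fintype.card_fin]
    rw [← Nat.cast_smul_eq_nsmul ℂ, smul_smul, h1, one_smul]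
    rfl
  rw [hN]
  exact star_mul_self_nonneg N

/-- Every completely positive map has operation elements. -/
theorem Channel.exists_hasOperationElements (𝓔 : Channel H) :
    ∃ K : Fin (Module.finrank ℂ H) × Fin (Module.finrank ℂ H) → (H →L[ℂ] H),
      𝓔.HasOperationElements K := by
  obtain ⟨B, hB⟩ := exists_eq_star_mul_self_of_nonneg
    (𝓔.map_cstarMatrix_nonneg' _ _ matrixUnit_nonneg)
  have hB' : ∀ i j, 𝓔.toLinearMap (matrixUnit i j) = ∑ k, star (B k i) * B k j := fun i j => by
    have := congrArg (fun M => M i j) hB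
    simp only [CStarMatrix.mul_apply] at this
    exact this
  let e := stdOrthonormalBasis ℂ H
  -- `K (k, l)` sends `e i` to `B_{ki}† e_l`; summing over `l` with `∑ |e_l⟩⟨e_l| = 1` yields
  -- `B_{ki}† B_{kj}`.
  let K : Fin (Module.finrank ℂ H) × Fin (Module.finrank ℂ H) → (H →L[ℂ] H) := fun c =>
    ∑ i, InnerProductSpace.rankOne ℂ (star (B c.1 i) (e c.2)) (e i)
  have hKe : ∀ c i, K c (e i) = star (B c.1 i) (e c.2) := fun c i => by
    simp [K, sum_apply, e.inner_eq_ite]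
  refine ⟨K, fun ρ => ?_⟩
  have hunit : ∀ i j, 𝓔.toLinearMap (matrixUnit i j) = ∑ c, K c * matrixUnit i j * star (K c) := by
    intro i j
    rw [hB', Fintype.sum_prod_type]
    refine Finset.sum_congr rfl fun k _ => ?_
    ext v
    simp only [mul_matrixUnit_mul_star, sum_apply, InnerProductSpace.rankOne_apply]
    change _ = ∑ l, inner ℂ (K (k, l) (e j)) v • K (k, l) (e i)
    simp only [hKe, ContinuousLinearMap.star_eq_adjoint, ContinuousLinearMap.adjoint_inner_left,
      ← map_smul, ← map_sum, e.sum_repr']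
    rfl
  rw [eq_sum_matrixUnit ρ]
  simp only [map_sum, map_smul, hunit, Finset.mul_sum, Finset.sum_mul, Finset.smul_sum,
    mul_smul_comm, smul_mul_assoc]
  symm
  rw [Finset.sum_comm]
  refine Finset.sum_congr rfl fun i _ => ?_
  rw [Finset.sum_comm]

end Kraus

/-! ### The two implications. -/

section Correctability

variable {H : Type*} [NormedAddCommGroup H] [InnerProductSpace ℂ H] [FiniteDimensional ℂ H]
  [CompleteSpace H] {ι : Type*} [Fintype ι]

theorem commute_of_isCorrectable {𝓔 : Channel H} {E : ι → (H →L[ℂ] H)}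
    (hE : 𝓔.HasOperationElements E) {P : H →L[ℂ] H} (hP : IsStarProjection P)
    {𝓐 : NonUnitalStarSubalgebra ℂ (H →L[ℂ] H)} (h𝓐 : ∀ X ∈ 𝓐, P * X * P = X)
    (h : IsCorrectable (𝓐 : Set (H →L[ℂ] H)) 𝓔 P) {X : H →L[ℂ] H} (hX : X ∈ 𝓐) (a b : ι) :
    P * star (E a) * E b * P * X = X * (P * star (E a) * E b * P) := by
  obtain ⟨𝓡, h𝓡⟩ := h
  obtain ⟨R, hR⟩ := 𝓡.exists_hasOperationElements
  have hp : star P = P := hP.isSelfAdjoint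
  have hpp : P * P = P := hP.isIdempotentElem
  have hl : ∀ X ∈ 𝓐, P * X = X := fun X hX => by
    rw [← h𝓐 X hX]; simp only [← mul_assoc, hpp]
  have hr : ∀ X ∈ 𝓐, X * P = X := fun X hX => by
    rw [← h𝓐 X hX]; simp only [mul_assoc, hpp]
  have hR1 := Channel.sum_star_mul_self hR
  have hE1 := Channel.sum_star_mul_self hE
  let K : (Fin (Module.finrank ℂ H) × Fin (Module.finrank ℂ H)) × ι → (H →L[ℂ] H) :=
    fun c => R c.1 * E c.2
  have hK : ∀ ρ, (𝓡.toLinearMap ∘ₗ 𝓔.toLinearMap) ρ = ∑ c, K c * ρ * star (K c) := fun ρ => by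
    rw [LinearMap.comp_apply, hE, hR]
    simp only [K, Fintype.sum_prod_type, Finset.mul_sum, Finset.sum_mul, star_mul, mul_assoc]
  have hK1 : ∑ c, star (K c) * K c = 1 := by
    rw [Fintype.sum_prod_type, Finset.sum_comm, ← hE1]
    refine Finset.sum_congr rfl fun a _ => ?_
    calc ∑ d, star (K (d, a)) * K (d, a) = star (E a) * (∑ d, star (R d) * R d) * E a := by
          simp only [K, Finset.mul_sum, Finset.sum_mul, star_mul, mul_assoc]
      _ = _ := by rw [hR1, mul_one]
  have hfix : ∀ X ∈ 𝓐, P * (∑ c, star (K c) * X * K c) * P = X := fun X hX => by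
    rw [← hsDual_eq_sum hK, h𝓡 X hX, h𝓐 X hX]
  have hint : ∀ X ∈ 𝓐, ∀ d a, X * (R d * E a) * P = R d * E a * X := fun X hX d a =>
    mul_mul_eq_of_compression hP (h𝓐 X hX) hK1 (hfix X hX)
      (hfix _ (mul_mem (star_mem hX) hX)) (d, a)
  -- The adjoint of the intertwining relation for `X†`.
  have hint' : ∀ d, X * (P * star (E a) * star (R d)) = P * star (E a) * star (R d) * X := by
    intro d
    have := congrArg star (hint (star X) (star_mem hX) d a)
    simp only [star_mul, star_star, hp] at this
    rw [mul_assoc P, mul_assoc P, this, ← mul_assoc X P, hr X hX]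
  calc P * star (E a) * E b * P * X
      = P * star (E a) * (∑ d, star (R d) * R d) * E b * X := by
        rw [hR1, mul_assoc _ P X, hl X hX, mul_one]
    _ = ∑ d, P * star (E a) * star (R d) * (R d * E b * X) := by
        simp only [Finset.mul_sum, Finset.sum_mul, mul_assoc]
    _ = ∑ d, X * (P * star (E a) * star (R d)) * (R d * E b) * P := by
        refine Finset.sum_congr rfl fun d _ => ?_
        rw [← hint X hX d b, hint' d]
        simp only [mul_assoc]
    _ = X * (P * star (E a) * (∑ d, star (R d) * R d) * E b * P) := by
        simp only [Finset.mul_sum, Finset.sum_mul, mul_assoc]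
    _ = _ := by rw [hR1, mul_one]

/-- The inverse square root of a positive operator on its support, by functional calculus. -/
theorem exists_inv_sqrt_on_support {M : H →L[ℂ] H} (hM : 0 ≤ M) :
    ∃ G : H →L[ℂ] H, IsSelfAdjoint G ∧ (∀ Y, Commute M Y → Commute G Y) ∧
      G * G * M * M = M := by
  have hsa : IsSelfAdjoint M := .of_nonneg hM
  -- The value at 0 is immaterial: the identity needed is `f(x)² x² = x`, which holds trivially
  -- there.
  let f : ℝ → ℝ := fun x => (Real.sqrt x)⁻¹
  have hf : ContinuousOn f (spectrum ℝ M) := (finite_spectrum_real M).continuousOn f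
  refine ⟨cfc f M, cfc_predicate f M, fun Y hY => ?_, ?_⟩
  · exact hsa.commute_cfc hY f
  · have h1 : cfc (fun x : ℝ => x) M = M := cfc_id' ℝ M
    conv_lhs => rw [← h1, cfc_id' ℝ M]
    calc cfc f M * cfc f M * M * M
        = cfc f M * cfc f M * cfc (fun x : ℝ => x) M * cfc (fun x : ℝ => x) M := by rw [h1]
      _ = cfc (fun x => f x * f x * x * x) M := by
        rw [← cfc_mul f f M, ← cfc_mul (fun x => f x * f x) _ M, ← cfc_mul _ _ M]
      _ = cfc (fun x : ℝ => x) M := by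
        refine cfc_congr fun x hx => ?_
        have hx0 : 0 ≤ x := spectrum_nonneg_of_nonneg hM hx
        rcases hx0.eq_or_lt with rfl | hx0
        · simp
        · have : f x * f x * x = 1 := by
            simp only [f]
            rw [← mul_inv, Real.mul_self_sqrt hx0.le, inv_mul_cancel₀ hx0.ne']
          simp only [this, one_mul]
      _ = M := h1

/-- The recovery channel has operation elements `P Eₐ† M^{-1/2}`, where `M = ∑ Eₐ P Eₐ†`, and the
projection onto the kernel of `M`. -/
theorem isCorrectable_of_commute {𝓔 : Channel H} {E : ι → (H →L[ℂ] H)}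
    (hE : 𝓔.HasOperationElements E) {P : H →L[ℂ] H} (hP : IsStarProjection P)
    {S : Set (H →L[ℂ] H)} (hS : ∀ X ∈ S, P * X * P = X)
    (h : ∀ X ∈ S, ∀ a b, P * star (E a) * E b * P * X = X * (P * star (E a) * E b * P)) :
    IsCorrectable S 𝓔 P := by
  have hp : star P = P := hP.isSelfAdjoint
  have hpp : P * P = P := hP.isIdempotentElem
  have hl : ∀ X ∈ S, P * X = X := fun X hX => by
    rw [← hS X hX]; simp only [← mul_assoc, hpp]
  have hE1 := Channel.sum_star_mul_self hE
  let F : ι → (H →L[ℂ] H) := fun a => E a * P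
  have hF : ∀ a, F a = E a * P := fun a => rfl
  have hFX : ∀ X ∈ S, ∀ a b, star (F a) * F b * X = X * (star (F a) * F b) := fun X hX a b => by
    simpa only [F, star_mul, hp, mul_assoc] using h X hX a b
  have hF1 : ∑ a, star (F a) * F a = P := by
    calc ∑ a, star (F a) * F a = P * (∑ a, star (E a) * E a) * P := by
          simp only [F, star_mul, hp, Finset.mul_sum, Finset.sum_mul, mul_assoc]
      _ = P := by rw [hE1, mul_one, hpp]
  clear_value F
  let M : H →L[ℂ] H := ∑ a, F a * star (F a)
  have hM : 0 ≤ M := Finset.sum_nonneg fun a _ => mul_star_self_nonneg (F a)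
  obtain ⟨G, hG, hGc, hGM⟩ := exists_inv_sqrt_on_support hM
  have hGs : star G = G := hG
  have hGM' : G * M = M * G := hGc M (Commute.refl M)
  -- `G M G` is the support projection of `M`; `Q` completes the recovery to a trace-preserving map.
  let Q : H →L[ℂ] H := 1 - G * M * G
  have hQs : star Q = Q := by
    simp only [Q, star_sub, star_one, star_mul, hGs, (IsSelfAdjoint.of_nonneg hM).star_eq,
      mul_assoc]
  have hQM : Q * M = 0 := by
    rw [sub_mul, one_mul, mul_assoc G M G, ← hGM', ← mul_assoc, hGM, sub_self]
  have hQQ : Q * Q = Q := by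
    conv_lhs => rw [show Q * Q = Q * (1 - G * M * G) from rfl]
    rw [hGM', mul_sub, mul_assoc, ← mul_assoc, hQM, zero_mul, mul_one, sub_zero]
  have hQF : ∀ a, Q * F a = 0 := fun a => by
    have h0 : ∑ a, star (star (F a) * Q) * (star (F a) * Q) = 0 := by
      calc _ = Q * M * Q := by
            simp only [M, star_mul, star_star, hQs, Finset.mul_sum, Finset.sum_mul, mul_assoc]
        _ = 0 := by rw [hQM, zero_mul]
    have := congrArg star (sum_star_mul_self_eq_zero h0 a)
    simpa only [star_mul, star_star, hQs, star_zero] using this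
  let R : Option ι → (H →L[ℂ] H) := fun c => c.elim Q fun a => star (F a) * G
  have hR1 : ∑ c, star (R c) * R c = 1 := by
    rw [Fintype.sum_option]
    calc _ = Q * Q + G * M * G := by
          simp only [R, M, Option.elim, star_mul, star_star, hQs, hGs, Finset.mul_sum,
            Finset.sum_mul, mul_assoc]
      _ = 1 := by rw [hQQ]; exact sub_add_cancel _ _
  refine ⟨Channel.ofOperationElements R hR1, fun X hX => ?_⟩
  have hR := Channel.hasOperationElements_ofOperationElements R hR1
  let Y : H →L[ℂ] H := ∑ a, F a * X * star (F a)
  have hYF : ∀ a, Y * F a = M * F a * X := fun a => by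
    simp only [Y, M, Finset.sum_mul, mul_assoc]
    refine Finset.sum_congr rfl fun b _ => ?_
    rw [← mul_assoc (star (F b)), hFX X hX b a]
  -- Both products equal `∑ M F_a X F_a†`, so `G` commutes with `Y` as well.
  have hMY : Commute M Y := by
    calc M * Y = ∑ a, M * F a * X * star (F a) := by
          simp only [Y, Finset.mul_sum, mul_assoc]
      _ = Y * M := by
          simp only [← hYF, M, Finset.mul_sum, mul_assoc]
  have hrec : ∀ a, G * Y * G * F a = F a * X := fun a => by
    have h1 : G * M * G * F a = F a := by
      have := hQF a
      rw [sub_mul, one_mul, sub_eq_zero] at this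
      exact this.symm
    rw [mul_assoc G Y G, ← (hGc Y hMY).eq, ← mul_assoc, mul_assoc _ Y, hYF, ← mul_assoc,
      ← mul_assoc, mul_assoc G G M, hGM', ← mul_assoc, h1]
  let K : Option ι × ι → (H →L[ℂ] H) := fun c => R c.1 * E c.2
  have hK : ∀ ρ, ((Channel.ofOperationElements R hR1).toLinearMap ∘ₗ 𝓔.toLinearMap) ρ =
      ∑ c, K c * ρ * star (K c) := fun ρ => by
    rw [LinearMap.comp_apply, hE, hR]
    simp only [K, Fintype.sum_prod_type, Finset.mul_sum, Finset.sum_mul, star_mul, mul_assoc]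
  rw [hsDual_eq_sum hK, Fintype.sum_prod_type, Finset.sum_comm, hS X hX]
  -- The element `Q` contributes nothing because `Q F_a = 0`.
  calc P * (∑ a, ∑ c, star (K (c, a)) * X * K (c, a)) * P
      = ∑ a, star (F a) * (star Q * X * (Q * F a) + G * Y * G * F a) := by
        simp only [Finset.mul_sum, Finset.sum_mul]
        refine Finset.sum_congr rfl fun a _ => ?_
        rw [Fintype.sum_option]
        simp only [K, R, Y, hF, Option.elim, star_mul, star_star, hp, hGs, Finset.mul_sum,
          Finset.sum_mul, mul_add, mul_assoc]
    _ = ∑ a, star (F a) * F a * X := by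
        simp only [hQF, hrec, mul_zero, zero_add, ← mul_assoc]
    _ = X := by rw [← Finset.sum_mul, hF1, hl X hX]

end Correctability

end OAQEC

theorem theorem3 {H : Type*} [NormedAddCommGroup H] [InnerProductSpace ℂ H]
    [FiniteDimensional ℂ H] [CompleteSpace H] {ι : Type*} [Fintype ι]
    (𝓔 : OAQEC.Channel H) (E : ι → (H →L[ℂ] H)) (hE : 𝓔.HasOperationElements E)
    (P : H →L[ℂ] H) (hP : IsStarProjection P)
    (𝓐 : NonUnitalStarSubalgebra ℂ (H →L[ℂ] H)) (h𝓐 : ∀ X ∈ 𝓐, P * X * P = X) :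
    OAQEC.IsCorrectable (𝓐 : Set (H →L[ℂ] H)) 𝓔 P ↔
      ∀ X ∈ 𝓐, ∀ a b : ι, ⁅P * star (E a) * E b * P, X⁆ = 0 := by
  simp only [Ring.lie_def, sub_eq_zero]
  exact ⟨fun h X hX a b => OAQEC.commute_of_isCorrectable hE hP h𝓐 h hX a b,
    fun h => OAQEC.isCorrectable_of_commute hE hP h𝓐 h⟩
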